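/- Let $\mathbb K$ be $\mathbb R$ or $\mathbb C$, let $(\Omega,\mu)$ be an arbitrary measure space, and let $\ell_1=\ell_1(\mathbb N)$ and $L_1(\mu)$ be the usual Banach lattices of $\mathbb K$-valued sequences and functions. Write $x\perp y$ if $|x|\wedge|y|=0$. A bounded linear operator $T:\ell_1\to L_1(\mu)$ is positive ($T\ge 0$) if $Tx\ge 0$ for every $x\ge 0$, and $S\le T$ means that $T-S$ is positive; $T$ is disjointness preserving if $Tx\perp Ty$ whenever $x\perp y$, and $\varepsilon$-disjointness preserving if $$\big\|\,|Tx|\wedge|Ty|\,\big\|\le\varepsilon\max\{\|x\|,\|y\|\}\qquad\text{whenever } x\perp y .$$ **Theorem.** Let $T:\ell_1\to L_1(\mu)$ be a positive $\varepsilon$-disjointness preserving operator, where $0<\varepsilon<\|T\|/16$. Then there is a positive disjointness preserving operator $S:\ell_1\to L_1(\mu)$ such that $0\le S\le T$ and $$\|T-S\|\le 2\sqrt{\frac{2\varepsilon\|T\|}{3}} .$$ -/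

import Mathlib

open MeasureTheory
open scoped ENNReal ComplexOrder

noncomputable section

/-- The real or complex sequence space `ℓ₁`, indexed by `ℕ`, with its usual norm. -/
abbrev SeqL1 (𝕜 : Type*) [RCLike 𝕜] : Type _ := lp (fun _ : ℕ => 𝕜) 1

/-- The real or complex space `L₁(μ)`. -/
abbrev FunL1 (𝕜 : Type*) [RCLike 𝕜] {Ω : Type*} [MeasurableSpace Ω] (μ : Measure Ω) : Type _ :=
  Lp 𝕜 1 μ

/-- Membership in the positive cone of `ℓ₁`: all coordinates are real and nonnegative. -/
def SeqNonneg {𝕜 : Type*} [RCLike 𝕜] (x : SeqL1 𝕜) : Prop := ∀ n, 0 ≤ x n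

/-- Membership in the positive cone of `L₁(μ)`: almost all values are real and nonnegative. -/
def FunNonneg {𝕜 : Type*} [RCLike 𝕜] {Ω : Type*} [MeasurableSpace Ω] {μ : Measure Ω}
    (f : FunL1 𝕜 μ) : Prop :=
  ∀ᵐ ω ∂μ, 0 ≤ f ω

/-- Disjointness `|x| ∧ |y| = 0` in the (real or complex) Banach lattice `ℓ₁`. -/
def SeqDisjoint {𝕜 : Type*} [RCLike 𝕜] (x y : SeqL1 𝕜) : Prop := ∀ n, ‖x n‖ ⊓ ‖y n‖ = 0

/-- The modulus `|f|` of an element of `L₁(μ)`, as an element of the real Banach lattice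
`L₁(μ)`. -/
def funModulus {𝕜 : Type*} [RCLike 𝕜] {Ω : Type*} [MeasurableSpace Ω] {μ : Measure Ω}
    (f : FunL1 𝕜 μ) : Lp ℝ 1 μ :=
  (Lp.memLp f).norm.toLp (fun ω => ‖f ω‖)

/-- Positive operators: `x ≥ 0` implies `T x ≥ 0`. -/
def IsPositiveOp {𝕜 : Type*} [RCLike 𝕜] {Ω : Type*} [MeasurableSpace Ω] {μ : Measure Ω}
    (T : SeqL1 𝕜 →L[𝕜] FunL1 𝕜 μ) : Prop :=
  ∀ x : SeqL1 𝕜, SeqNonneg x → FunNonneg (T x)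

/-- The order between operators: `S ≤ T` means that `T - S` is positive. -/
def OpLE {𝕜 : Type*} [RCLike 𝕜] {Ω : Type*} [MeasurableSpace Ω] {μ : Measure Ω}
    (S T : SeqL1 𝕜 →L[𝕜] FunL1 𝕜 μ) : Prop :=
  IsPositiveOp (T - S)

/-- `T` is disjointness preserving: `T x ⊥ T y` whenever `x ⊥ y`. -/
def IsDP {𝕜 : Type*} [RCLike 𝕜] {Ω : Type*} [MeasurableSpace Ω] {μ : Measure Ω}
    (T : SeqL1 𝕜 →L[𝕜] FunL1 𝕜 μ) : Prop :=
  ∀ x y : SeqL1 𝕜, SeqDisjoint x y → funModulus (T x) ⊓ funModulus (T y) = 0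

/-- `T` is `ε`-disjointness preserving: `‖|T x| ∧ |T y|‖ ≤ ε max {‖x‖, ‖y‖}` whenever
`x ⊥ y`. -/
def IsAlmostDP {𝕜 : Type*} [RCLike 𝕜] {Ω : Type*} [MeasurableSpace Ω] {μ : Measure Ω}
    (ε : ℝ) (T : SeqL1 𝕜 →L[𝕜] FunL1 𝕜 μ) : Prop :=
  ∀ x y : SeqL1 𝕜, SeqDisjoint x y →
    ‖funModulus (T x) ⊓ funModulus (T y)‖ ≤ ε * max ‖x‖ ‖y‖

end

/-! Put `f n = |T eₙ|`. It is enough to find disjoint sets `A n` with `∫_{(A n)ᶜ} f n ≤ 16ε/3` for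
all `n`; then `S eₙ = 1_{A n} T eₙ` works, since the norm of an operator on `ℓ₁` is read off the
unit vectors.

For fixed weights `a` on a finite `F` with sum 1, let the `n`-th set be where `a n * f n` is the
largest term. The hypothesis bounds the integrated smaller half of every splitting of `F` by `ε`.
Averaged over all splittings, the smaller half is pointwise at least 3/8 of all terms but the
largest (`sum_powerset_min_ge`), so the weighted loss is at most `8ε/3`.

These sets depend on the weights. Sion's minimax theorem removes the dependence after sets are
relaxed to functions `φ n ≥ 0` with `φ n + φ m ≤ 1`, a convex weak-* compact family: some `φ` has `∫
(1 - φ n) f n ≤ 8ε/3` for all `n`. Rounding to `{φ n > 1/2}` restores disjointness and costs a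
factor 2. -/

theorem sum_powerset_sq_signed_sum {ι : Type*} [DecidableEq ι] (F : Finset ι) (b : ι → ℝ) :
    ∑ I ∈ F.powerset, (∑ i ∈ I, b i - ∑ i ∈ F \ I, b i) ^ 2 = 2 ^ F.card * ∑ i ∈ F, b i ^ 2 := by
  induction F using Finset.induction_on with
  | empty => simp
  | insert k G hk ih =>
    rw [Finset.sum_powerset_insert hk, ← Finset.sum_add_distrib, Finset.card_insert_of_notMem hk,
      Finset.sum_insert hk]
    have h : ∀ I ∈ G.powerset,
        (∑ i ∈ I, b i - ∑ i ∈ insert k G \ I, b i) ^ 2 +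
          (∑ i ∈ insert k I, b i - ∑ i ∈ insert k G \ insert k I, b i) ^ 2 =
        2 * (∑ i ∈ I, b i - ∑ i ∈ G \ I, b i) ^ 2 + 2 * b k ^ 2 := by
      intro I hI
      have hkI : k ∉ I := fun h => hk (Finset.mem_powerset.1 hI h)
      rw [Finset.insert_sdiff_of_notMem _ hkI, Finset.insert_sdiff_insert,
        Finset.sum_insert (by simp [hk]), Finset.sum_insert hkI,
        Finset.sdiff_insert_of_notMem hk]
      ring
    rw [Finset.sum_congr rfl h, Finset.sum_add_distrib, ← Finset.mul_sum, ih]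
    simp only [Finset.sum_const, Finset.card_powerset, nsmul_eq_mul]
    push_cast
    ring

/-! ### Averaging over splittings -/

/-- The right side equals `x + y - (|x - y| - m)⁺`, and `|z| ≤ m + z²/(4m)` by AM-GM. The quadratic
bound is what can be averaged over signs. -/
theorem min_add_min_ge {m x y : ℝ} (hm : 0 < m) :
    x + y - (x - y) ^ 2 / (4 * m) ≤ min x (m + y) + min (m + x) y := by
  have h : ∀ z : ℝ, |z| ≤ m + z ^ 2 / (4 * m) := by
    intro z
    have : z ^ 2 / (4 * m) = |z| ^ 2 / (4 * m) := by rw [sq_abs]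
    rw [this, ← sub_nonneg]
    have : m + |z| ^ 2 / (4 * m) - |z| = (|z| - 2 * m) ^ 2 / (4 * m) := by field_simp; ring
    rw [this]
    positivity
  have hz := h (x - y)
  have hp : 0 ≤ (x - y) ^ 2 / (4 * m) := by positivity
  have := le_abs_self (x - y)
  have := neg_abs_le (x - y)
  rcases min_cases x (m + y) with ⟨h1, _⟩ | ⟨h1, _⟩ <;>
    rcases min_cases (m + x) y with ⟨h2, _⟩ | ⟨h2, _⟩ <;> rw [h1, h2] <;> linarith

/-- Averaging over all splittings of `F`: the smaller half is, on average, at least `3/8` of the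
sum of all terms but the largest one. -/
theorem sum_powerset_min_ge {ι : Type*} [DecidableEq ι] (F : Finset ι) (b : ι → ℝ)
    (hb : ∀ i ∈ F, 0 ≤ b i) {k : ι} (hk : k ∈ F) (hmax : ∀ i ∈ F, b i ≤ b k) :
    3 / 8 * 2 ^ F.card * ∑ i ∈ F.erase k, b i ≤
      ∑ I ∈ F.powerset, min (∑ i ∈ I, b i) (∑ i ∈ F \ I, b i) := by
  have hpos : ∀ I ∈ F.powerset, 0 ≤ min (∑ i ∈ I, b i) (∑ i ∈ F \ I, b i) := by
    intro I hI
    exact le_min (Finset.sum_nonneg fun i hi => hb i (Finset.mem_powerset.1 hI hi))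
      (Finset.sum_nonneg fun i hi => hb i (Finset.mem_sdiff.1 hi).1)
  rcases (hb k hk).eq_or_lt with h0 | hm
  · have : ∑ i ∈ F.erase k, b i = 0 := Finset.sum_eq_zero fun i hi => by
      have hi' := Finset.mem_of_mem_erase hi
      exact le_antisymm (h0 ▸ hmax i hi') (hb i hi')
    rw [this, mul_zero]
    exact Finset.sum_nonneg hpos
  set G := F.erase k with hG
  have hkG : k ∉ G := Finset.notMem_erase k F
  have hF : F = insert k G := (Finset.insert_erase hk).symm
  have hGF : ∀ i ∈ G, i ∈ F := fun i hi => Finset.mem_of_mem_erase hi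
  rw [hF, Finset.sum_powerset_insert hkG, ← Finset.sum_add_distrib,
    Finset.card_insert_of_notMem hkG]
  -- Pair the splittings that differ only in the side containing the largest term `k`.
  have h : ∀ I ∈ G.powerset,
      ∑ i ∈ G, b i - (∑ i ∈ I, b i - ∑ i ∈ G \ I, b i) ^ 2 / (4 * b k) ≤
      min (∑ i ∈ I, b i) (∑ i ∈ insert k G \ I, b i) +
        min (∑ i ∈ insert k I, b i) (∑ i ∈ insert k G \ insert k I, b i) := by
    intro I hI
    have hIG := Finset.mem_powerset.1 hI
    have hkI : k ∉ I := fun h => hkG (hIG h)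
    rw [Finset.insert_sdiff_of_notMem _ hkI, Finset.insert_sdiff_insert,
        Finset.sum_insert (by simp [hkG]), Finset.sum_insert hkI,
        Finset.sdiff_insert_of_notMem hkG, ← Finset.sum_sdiff hIG, add_comm (∑ i ∈ G \ I, b i)]
    exact min_add_min_ge hm
  refine le_trans ?_ (Finset.sum_le_sum h)
  rw [Finset.sum_sub_distrib, ← Finset.sum_div, sum_powerset_sq_signed_sum]
  simp only [Finset.sum_const, Finset.card_powerset, nsmul_eq_mul]
  -- The mean square is thus at most `b k * ∑ b i`, so a pair keeps on average `1 - 1/4` of the sum,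
  -- a single splitting 3/8.
  have hsq : ∑ i ∈ G, b i ^ 2 ≤ b k * ∑ i ∈ G, b i := by
    rw [Finset.mul_sum]
    refine Finset.sum_le_sum fun i hi => ?_
    rw [sq]
    exact mul_le_mul_of_nonneg_right (hmax i (hGF i hi)) (hb i (hGF i hi))
  have h4 : 2 ^ G.card * (∑ i ∈ G, b i ^ 2) / (4 * b k) ≤ 2 ^ G.card * (∑ i ∈ G, b i) / 4 := by
    rw [div_le_div_iff₀ (by positivity) (by norm_num)]
    have := mul_le_mul_of_nonneg_left hsq (show (0 : ℝ) ≤ 2 ^ G.card by positivity)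
    nlinarith
  push_cast
  rw [pow_succ]
  linarith

/-- Disjoint measurable sets on which the `n`-th function of a finite family is the largest. -/
theorem exists_argmax_sets {Ω : Type*} [MeasurableSpace Ω] (F : Finset ℕ) (hF : F.Nonempty)
    (b : ℕ → Ω → ℝ) (hb : ∀ n, Measurable (b n)) :
    ∃ B : ℕ → Set Ω, (∀ n, MeasurableSet (B n)) ∧ Pairwise (Function.onFun Disjoint B) ∧
      ∀ ω, ∃ k ∈ F, ω ∈ B k ∧ ∀ i ∈ F, b i ω ≤ b k ω := by
  classical
  let B₀ : ℕ → Set Ω := fun n => {ω | n ∈ F ∧ ∀ i ∈ F, b i ω ≤ b n ω}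
  have hB₀ : ∀ n, MeasurableSet (B₀ n) := by
    intro n
    have : B₀ n = {ω | n ∈ F} ∩ ⋂ i ∈ F, {ω | b i ω ≤ b n ω} := by
      ext ω; simp [B₀]
    rw [this]
    exact (MeasurableSet.const _).inter
      (F.measurableSet_biInter fun i _ => measurableSet_le (hb i) (hb n))
  -- `disjointed` gives ties to the smallest index.
  refine ⟨disjointed B₀, MeasurableSet.disjointed hB₀, disjoint_disjointed B₀, fun ω => ?_⟩
  obtain ⟨j, hj, hj'⟩ := F.exists_max_image (fun i => b i ω) hF
  have : ω ∈ ⋃ n, disjointed B₀ n := by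
    rw [iUnion_disjointed]
    exact Set.mem_iUnion.2 ⟨j, hj, hj'⟩
  obtain ⟨k, hk⟩ := Set.mem_iUnion.1 this
  have hk' : ω ∈ B₀ k := disjointed_subset B₀ k hk
  exact ⟨k, hk'.1, hk, hk'.2⟩

/-- If any two complementary weighted sums of a finite family almost do not overlap, then the
family can be split, in the weighted mean, along disjoint sets. -/
theorem exists_disjoint_sets_weighted {Ω : Type*} [MeasurableSpace Ω] {μ : Measure Ω}
    {f : ℕ → Ω → ℝ} (hf : ∀ n, Measurable (f n)) (hf0 : ∀ n ω, 0 ≤ f n ω)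
    (hfi : ∀ n, Integrable (f n) μ) {ε : ℝ} (F : Finset ℕ) (a : ℕ → ℝ) (ha : ∀ n, 0 ≤ a n)
    (hF : F.Nonempty)
    (h : ∀ I ⊆ F, ∫ ω, min (∑ i ∈ I, a i * f i ω) (∑ i ∈ F \ I, a i * f i ω) ∂μ ≤ ε) :
    ∃ B : ℕ → Set Ω, (∀ n, MeasurableSet (B n)) ∧ Pairwise (Function.onFun Disjoint B) ∧
      ∑ n ∈ F, a n * ∫ ω in (B n)ᶜ, f n ω ∂μ ≤ 8 / 3 * ε := by
  classical
  obtain ⟨B, hBm, hBd, hB⟩ := exists_argmax_sets F hF (fun n ω => a n * f n ω)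
    (fun n => (hf n).const_mul _)
  refine ⟨B, hBm, hBd, ?_⟩
  have hsum : ∀ I : Finset ℕ, Integrable (fun ω => ∑ i ∈ I, a i * f i ω) μ := fun I =>
    integrable_finsetSum _ fun i _ => (hfi i).const_mul _
  have hmin : ∀ I : Finset ℕ, Integrable
      (fun ω => min (∑ i ∈ I, a i * f i ω) (∑ i ∈ F \ I, a i * f i ω)) μ := fun I =>
    (hsum I).inf (hsum _)
  have hind : ∀ n, Integrable (fun ω => a n * (B n)ᶜ.indicator (f n) ω) μ := fun n =>
    ((hfi n).indicator (hBm n).compl).const_mul _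
  have key : ∀ ω, 3 / 8 * 2 ^ F.card * ∑ n ∈ F, a n * (B n)ᶜ.indicator (f n) ω ≤
      ∑ I ∈ F.powerset, min (∑ i ∈ I, a i * f i ω) (∑ i ∈ F \ I, a i * f i ω) := by
    intro ω
    obtain ⟨k, hk, hkB, hmax⟩ := hB ω
    refine le_trans (le_of_eq ?_) (sum_powerset_min_ge F (fun n => a n * f n ω)
      (fun i _ => mul_nonneg (ha i) (hf0 i ω)) hk hmax)
    congr 1
    rw [← Finset.add_sum_erase _ _ hk, Set.indicator_of_notMem (by simpa using hkB), mul_zero,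
      zero_add]
    refine Finset.sum_congr rfl fun i hi => ?_
    rw [Set.indicator_of_mem]
    exact fun hiB => Set.disjoint_left.1 (hBd (Finset.ne_of_mem_erase hi)) hiB hkB
  have hint := integral_mono ((integrable_finsetSum F fun n _ => hind n).const_mul
    (3 / 8 * 2 ^ F.card)) (integrable_finsetSum F.powerset fun I _ => hmin I) key
  rw [integral_const_mul, integral_finsetSum _ fun n _ => hind n,
    integral_finsetSum _ fun I _ => hmin I] at hint
  have hle : ∑ I ∈ F.powerset,
      ∫ ω, min (∑ i ∈ I, a i * f i ω) (∑ i ∈ F \ I, a i * f i ω) ∂μ ≤ 2 ^ F.card * ε := by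
    refine (Finset.sum_le_card_nsmul _ _ ε fun I hI => h I (Finset.mem_powerset.1 hI)).trans_eq ?_
    simp
  simp only [integral_const_mul, integral_indicator (hBm _).compl] at hint
  have h2 : (0 : ℝ) < 2 ^ F.card := by positivity
  have := hint.trans hle
  rw [mul_comm (3 / 8 : ℝ), mul_assoc] at this
  have := le_of_mul_le_mul_left this h2
  linarith

/-! ### Minimax -/

/-- A minimax principle: if every convex combination of the affine inequalities `c n ≤ ℓ n x` has a
solution in the compact convex set `X`, then all of them have a common solution. -/
theorem exists_forall_le_of_convex_combinations {E : Type*} [TopologicalSpace E] [AddCommGroup E]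
    [Module ℝ E] [IsTopologicalAddGroup E] [ContinuousSMul ℝ E] {X : Set E} (hne : X.Nonempty)
    (hX : IsCompact X) (hc : Convex ℝ X) (ℓ : ℕ → E →L[ℝ] ℝ) (c : ℕ → ℝ)
    (h : ∀ (F : Finset ℕ) (a : ℕ → ℝ), (∀ n, 0 ≤ a n) → ∑ n ∈ F, a n = 1 →
      ∃ x ∈ X, ∑ n ∈ F, a n * (c n - ℓ n x) ≤ 0) :
    ∃ x ∈ X, ∀ n, c n ≤ ℓ n x := by
  classical
  have hfin : ∀ F : Finset ℕ, ∃ x ∈ X, ∀ n ∈ F, c n ≤ ℓ n x := by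
    intro F
    by_contra! hF
    let f : E → (ℕ → ℝ) → ℝ := fun x a => ∑ n ∈ F, a n * (c n - ℓ n x)
    let Y : Set (ℕ → ℝ) := {a | (∀ n, 0 ≤ a n) ∧ ∑ n ∈ F, a n = 1}
    have hY : Convex ℝ Y := by
      intro a ha b hb s t hs ht hst
      refine ⟨fun n => ?_, ?_⟩
      · have := ha.1 n
        have := hb.1 n
        simp only [Pi.add_apply, Pi.smul_apply, smul_eq_mul]
        positivity
      · simp only [Pi.add_apply, Pi.smul_apply, smul_eq_mul, Finset.sum_add_distrib,
          ← Finset.mul_sum, ha.2, hb.2, mul_one, hst]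
    have hcx : ∀ a, ConvexOn ℝ X fun x => f x a := by
      refine fun a => ⟨hc, fun x _ y _ s t _ _ hst => le_of_eq ?_⟩
      simp only [f, map_add, map_smul, smul_eq_mul, Finset.mul_sum, ← Finset.sum_add_distrib]
      refine Finset.sum_congr rfl fun n _ => ?_
      linear_combination -(a n * c n) * hst
    have hca : ∀ x, ConcaveOn ℝ Y fun a => f x a := by
      refine fun x => ⟨hY, fun a _ b _ s t _ _ _ => le_of_eq ?_⟩
      simp only [f, Pi.add_apply, Pi.smul_apply, smul_eq_mul, Finset.mul_sum,
        ← Finset.sum_add_distrib]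
      refine Finset.sum_congr rfl fun n _ => ?_
      ring
    -- If every `x` violates some inequality, some vertex of the simplex gives a positive payoff at
    -- `x`; Sion then gives one weight positive at every `x`. Using finitely many vertices matters:
    -- `Y` is not compact, its coordinates off `F` being unbounded.
    obtain ⟨a, ha, hlt⟩ := Sion.exists_lt_iInf_of_lt_iInf_of_finite (X := X) (Y := Y) (f := f)
      (t := 0) hne hX
      (fun a _ => (Continuous.lowerSemicontinuous (by fun_prop)).lowerSemicontinuousOn _)
      (fun a _ => (hcx a).quasiconvexOn) hY
      (fun x _ => (Continuous.upperSemicontinuous (by fun_prop)).upperSemicontinuousOn _)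
      (fun x _ => (hca x).quasiconcaveOn) hc
      (F.finite_toSet.image fun n => Pi.single n (1 : ℝ))
      (by
        rintro _ ⟨n, hn, rfl⟩
        refine ⟨fun m => ?_, ?_⟩
        · by_cases hm : m = n
          · subst hm; simp
          · simp [hm]
        · simpa [Finset.sum_pi_single'] using hn)
      (by
        intro x hx
        obtain ⟨n, hn, hlt⟩ := hF x hx
        refine ⟨_, ⟨n, hn, rfl⟩, ?_⟩
        have : f x (Pi.single n 1) = c n - ℓ n x := by
          simp only [f]
          rw [Finset.sum_eq_single_of_mem n hn]
          · simp
          · intro m _ hm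
            simp [hm]
        rw [this]
        linarith)
    obtain ⟨x, hx, hle⟩ := h F a ha.1 ha.2
    exact absurd (hlt x hx) (not_lt.2 hle)
  obtain ⟨x, hx, hx'⟩ := hX.inter_iInter_nonempty (fun n => {x | c n ≤ ℓ n x})
    (fun n => isClosed_le continuous_const (ℓ n).continuous)
    (fun F => by
      obtain ⟨x, hx, hF⟩ := hfin F
      exact ⟨x, hx, Set.mem_iInter₂.2 hF⟩)
  exact ⟨x, hx, Set.mem_iInter.1 hx'⟩

/-! ### Fractional splittings and rounding in a finite measure space -/

section FiniteMeasure

variable {Ω : Type*} [MeasurableSpace Ω] (ν : Measure Ω) [IsFiniteMeasure ν]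

/-- The class of a measurable set's indicator function in `L₂` of a finite measure. -/
noncomputable def indL2 (B : Set Ω) (hB : MeasurableSet B) : Lp ℝ 2 ν :=
  indicatorConstLp 2 hB (measure_ne_top ν B) (1 : ℝ)

theorem inner_indL2 (B : Set Ω) (hB : MeasurableSet B) (f : Lp ℝ 2 ν) :
    inner ℝ (indL2 ν B hB) f = ∫ ω in B, f ω ∂ν :=
  L2.inner_indicatorConstLp_one hB (measure_ne_top ν B) f

theorem inner_indL2_indL2 {B C : Set Ω} (hB : MeasurableSet B) (hC : MeasurableSet C) :
    inner ℝ (indL2 ν B hB) (indL2 ν C hC) = ν.real (B ∩ C) :=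
  L2.real_inner_indicatorConstLp_one_indicatorConstLp_one hB hC _ _

theorem norm_indL2_le (B : Set Ω) (hB : MeasurableSet B) :
    ‖indL2 ν B hB‖ ≤ √(ν.real Set.univ) := by
  rw [← Real.sqrt_sq (norm_nonneg _), ← real_inner_self_eq_norm_sq, inner_indL2_indL2]
  exact Real.sqrt_le_sqrt (measureReal_mono (Set.subset_univ _))

/-- The functionals on `L₂(ν)` given by families of functions `φ n ≥ 0` with `φ n + φ m ≤ 1` for
`n ≠ m`. -/
def fractionalSplittings : Set (ℕ → WeakDual ℝ (Lp ℝ 2 ν)) :=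
  {ψ | (∀ n, ψ n ∈ WeakDual.toStrongDual ⁻¹' Metric.closedBall 0 √(ν.real Set.univ)) ∧
    ∀ (B : Set Ω) (hB : MeasurableSet B), (∀ n, 0 ≤ ψ n (indL2 ν B hB)) ∧
      ∀ n m, n ≠ m → ψ n (indL2 ν B hB) + ψ m (indL2 ν B hB) ≤ ν.real B}

/-- Banach–Alaoglu and Tychonoff make the product of balls compact; the other constraints are closed
because they only involve evaluations at fixed vectors. -/
theorem isCompact_fractionalSplittings : IsCompact (fractionalSplittings ν) := by
  have h := isCompact_univ_pi fun _ : ℕ =>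
    WeakDual.isCompact_closedBall (𝕜 := ℝ) (E := Lp ℝ 2 ν) 0 √(ν.real Set.univ)
  have hev : ∀ (n : ℕ) (v : Lp ℝ 2 ν),
      Continuous fun ψ : ℕ → WeakDual ℝ (Lp ℝ 2 ν) => ψ n v :=
    fun n v => (WeakDual.eval_continuous v).comp (continuous_apply n)
  have : fractionalSplittings ν = (Set.univ.pi fun _ : ℕ =>
      WeakDual.toStrongDual ⁻¹' Metric.closedBall 0 √(ν.real Set.univ)) ∩
      {ψ | ∀ (B : Set Ω) (hB : MeasurableSet B), (∀ n, 0 ≤ ψ n (indL2 ν B hB)) ∧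
      ∀ n m, n ≠ m → ψ n (indL2 ν B hB) + ψ m (indL2 ν B hB) ≤ ν.real B} := by
    ext ψ
    simp [fractionalSplittings]
  rw [this]
  refine h.inter_right ?_
  simp only [Set.ofPred_forall, Set.ofPred_and]
  refine isClosed_iInter fun B => isClosed_iInter fun hB => IsClosed.inter ?_ ?_
  · exact isClosed_iInter fun n => isClosed_le continuous_const (hev n _)
  · exact isClosed_iInter fun n => isClosed_iInter fun m => isClosed_iInter fun _ =>
      isClosed_le ((hev n _).add (hev m _)) continuous_const

theorem convex_fractionalSplittings : Convex ℝ (fractionalSplittings ν) := by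
  intro ψ hψ χ hχ s t hs ht hst
  refine ⟨fun n => ?_, fun B hB => ⟨fun n => ?_, fun n m hnm => ?_⟩⟩
  · exact (convex_closedBall (0 : StrongDual ℝ (Lp ℝ 2 ν)) _) (hψ.1 n) (hχ.1 n) hs ht hst
  · have h1 := (hψ.2 B hB).1 n
    have h2 := (hχ.2 B hB).1 n
    change 0 ≤ s * ψ n (indL2 ν B hB) + t * χ n (indL2 ν B hB)
    positivity
  · have h1 := mul_le_mul_of_nonneg_left ((hψ.2 B hB).2 n m hnm) hs
    have h2 := mul_le_mul_of_nonneg_left ((hχ.2 B hB).2 n m hnm) ht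
    change s * ψ n (indL2 ν B hB) + t * χ n (indL2 ν B hB) +
      (s * ψ m (indL2 ν B hB) + t * χ m (indL2 ν B hB)) ≤ ν.real B
    have h3 : s * ν.real B + t * ν.real B = ν.real B := by rw [← add_mul, hst, one_mul]
    linarith

/-- A disjoint sequence of sets, as a fractional splitting. -/
noncomputable def splittingOfSets (B : ℕ → Set Ω) (hB : ∀ n, MeasurableSet (B n)) :
    ℕ → WeakDual ℝ (Lp ℝ 2 ν) :=
  fun n => StrongDual.toWeakDual (innerSL ℝ (indL2 ν (B n) (hB n)))

theorem splittingOfSets_apply (B : ℕ → Set Ω) (hB : ∀ n, MeasurableSet (B n)) (n : ℕ)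
    (v : Lp ℝ 2 ν) : splittingOfSets ν B hB n v = inner ℝ (indL2 ν (B n) (hB n)) v := rfl

theorem splittingOfSets_mem (B : ℕ → Set Ω) (hB : ∀ n, MeasurableSet (B n))
    (hd : Pairwise (Function.onFun Disjoint B)) :
    splittingOfSets ν B hB ∈ fractionalSplittings ν := by
  refine ⟨fun n => ?_, fun C hC => ⟨fun n => ?_, fun n m hnm => ?_⟩⟩
  · have : ‖innerSL ℝ (indL2 ν (B n) (hB n))‖ ≤ √(ν.real Set.univ) := by
      rw [innerSL_apply_norm]
      exact norm_indL2_le ν _ _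
    exact mem_closedBall_zero_iff.2 this
  · rw [splittingOfSets_apply, inner_indL2_indL2]
    exact measureReal_nonneg
  · rw [splittingOfSets_apply, splittingOfSets_apply, inner_indL2_indL2, inner_indL2_indL2,
      ← measureReal_union ((hd hnm).mono Set.inter_subset_left Set.inter_subset_left)
        ((hB m).inter hC)]
    exact measureReal_mono (Set.union_subset Set.inter_subset_right Set.inter_subset_right)

/-- A fractional splitting is represented by functions. -/
theorem exists_functions_of_mem_fractionalSplittings {ψ : ℕ → WeakDual ℝ (Lp ℝ 2 ν)}
    (hψ : ψ ∈ fractionalSplittings ν) :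
    ∃ φ : ℕ → Lp ℝ 2 ν, (∀ n v, ψ n v = inner ℝ (φ n) v) ∧
      (∀ n, ∀ᵐ ω ∂ν, 0 ≤ φ n ω) ∧ ∀ n m, n ≠ m → ∀ᵐ ω ∂ν, φ n ω + φ m ω ≤ 1 := by
  let φ : ℕ → Lp ℝ 2 ν := fun n =>
    (InnerProductSpace.toDual ℝ (Lp ℝ 2 ν)).symm (WeakDual.toStrongDual (ψ n))
  have hφ : ∀ n v, ψ n v = inner ℝ (φ n) v := fun n v =>
    (InnerProductSpace.toDual_symm_apply (𝕜 := ℝ) (x := v) (y := WeakDual.toStrongDual (ψ n))).symm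
  have hB : ∀ n (B : Set Ω) (hB : MeasurableSet B), ψ n (indL2 ν B hB) = ∫ ω in B, φ n ω ∂ν :=
    fun n B hB => by rw [hφ, real_inner_comm, inner_indL2]
  have hi : ∀ n, Integrable (φ n) ν := fun n => (Lp.memLp (φ n)).integrable (by norm_num)
  refine ⟨φ, hφ, fun n => ?_, fun n m hnm => ?_⟩
  · refine ae_nonneg_of_forall_setIntegral_nonneg (hi n) fun B hBm _ => ?_
    rw [← hB n B hBm]
    exact (hψ.2 B hBm).1 n
  · refine ae_le_of_forall_setIntegral_le ((hi n).add (hi m)) (integrable_const (1 : ℝ))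
      fun B hBm _ => ?_
    rw [integral_add (hi n).integrableOn (hi m).integrableOn, ← hB n B hBm, ← hB m B hBm,
      setIntegral_const, smul_eq_mul, mul_one]
    exact (hψ.2 B hBm).2 n m hnm

variable {ν}

/-- Weighted splittings along disjoint sets give a simultaneous splitting, in a finite measure
space. -/
theorem exists_disjoint_sets_of_weighted_finite {d : ℕ → Ω → ℝ} (hd : ∀ n, MemLp (d n) 2 ν)
    (hd0 : ∀ n ω, 0 ≤ d n ω) {s : ℝ}
    (h : ∀ (F : Finset ℕ) (a : ℕ → ℝ), (∀ n, 0 ≤ a n) → ∑ n ∈ F, a n = 1 →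
      ∃ B : ℕ → Set Ω, (∀ n, MeasurableSet (B n)) ∧ Pairwise (Function.onFun Disjoint B) ∧
        ∑ n ∈ F, a n * ∫ ω in (B n)ᶜ, d n ω ∂ν ≤ s) :
    ∃ A : ℕ → Set Ω, (∀ n, MeasurableSet (A n)) ∧ Pairwise (Function.onFun Disjoint A) ∧
      ∀ n, ∫ ω in (A n)ᶜ, d n ω ∂ν ≤ 2 * s := by
  let D : ℕ → Lp ℝ 2 ν := fun n => (hd n).toLp (d n)
  have hdi : ∀ n, Integrable (d n) ν := fun n => (hd n).integrable (by norm_num)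
  let ℓ : ℕ → (ℕ → WeakDual ℝ (Lp ℝ 2 ν)) →L[ℝ] ℝ := fun n =>
    { toFun := fun ψ => ψ n (D n)
      map_add' := fun _ _ => rfl
      map_smul' := fun _ _ => rfl
      cont := (WeakDual.eval_continuous (D n)).comp (continuous_apply n) }
  have hℓ : ∀ n ψ, ℓ n ψ = ψ n (D n) := fun _ _ => rfl
  obtain ⟨ψ, hψ, hle⟩ := exists_forall_le_of_convex_combinations
    ⟨_, splittingOfSets_mem ν (fun _ => ∅) (fun _ => MeasurableSet.empty)
      (fun _ _ _ => disjoint_bot_left)⟩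
    (isCompact_fractionalSplittings ν) (convex_fractionalSplittings ν) ℓ
    -- With this constant, `c n ≤ ℓ n ψ` says `∫ (1 - φ n) d n ≤ s`.
    (fun n => ∫ ω, d n ω ∂ν - s) (by
      intro F a ha hsum
      obtain ⟨B, hBm, hBd, hB⟩ := h F a ha hsum
      refine ⟨_, splittingOfSets_mem ν B hBm hBd, ?_⟩
      have : ∀ n, ∫ ω, d n ω ∂ν - s - ℓ n (splittingOfSets ν B hBm) =
          ∫ ω in (B n)ᶜ, d n ω ∂ν - s := by
        intro n
        rw [hℓ, splittingOfSets_apply, inner_indL2,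
          integral_congr_ae (ae_restrict_of_ae (hd n).coeFn_toLp),
          ← integral_add_compl (hBm n) (hdi n)]
        ring
      simp only [this, mul_sub, Finset.sum_sub_distrib, ← Finset.sum_mul, hsum]
      linarith)
  obtain ⟨φ, hφ, hφ0, hφ1⟩ := exists_functions_of_mem_fractionalSplittings ν hψ
  -- Two of the `φ n` cannot both exceed 1/2, and off `A n` one has `1 ≤ 2 (1 - φ n)`.
  let A : ℕ → Set Ω := fun n => {ω | 1 / 2 < φ n ω}
  have hAm : ∀ n, MeasurableSet (A n) := fun n =>
    measurableSet_lt measurable_const (Lp.stronglyMeasurable (φ n)).measurable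
  have hAd : Pairwise (Function.onFun (AEDisjoint ν) A) := by
    intro n m hnm
    refine measure_eq_zero_iff_ae_notMem.2 ?_
    filter_upwards [hφ1 n m hnm] with ω hω ⟨h1, h2⟩
    simp only [A, Set.mem_ofPred_eq] at h1 h2
    linarith
  have hAi : ∀ n, ∫ ω in (A n)ᶜ, d n ω ∂ν ≤ 2 * s := by
    intro n
    have hφd : Integrable (fun ω => φ n ω * d n ω) ν := (Lp.memLp (φ n)).integrable_mul (hd n)
    have hφi : ℓ n ψ = ∫ ω, φ n ω * d n ω ∂ν := by
      rw [hℓ, hφ, L2.inner_def]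
      refine integral_congr_ae ?_
      filter_upwards [(hd n).coeFn_toLp] with ω hω
      simp only [D, hω, RCLike.inner_apply, conj_trivial, mul_comm]
    have hn := hle n
    simp only [hφi] at hn
    rw [← integral_indicator (hAm n).compl]
    have : ∫ ω, (A n)ᶜ.indicator (d n) ω ∂ν ≤ ∫ ω, 2 * (d n ω - φ n ω * d n ω) ∂ν := by
      refine integral_mono_ae ((hdi n).indicator (hAm n).compl)
        (((hdi n).sub hφd).const_mul 2) ?_
      -- Any second index would do: it yields `φ n ≤ 1`.
      filter_upwards [hφ1 n (n + 1) (by simp), hφ0 (n + 1)] with ω h1 h0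
      have hd := hd0 n ω
      by_cases hω : ω ∈ A n
      · rw [Set.indicator_of_notMem (by simpa using hω)]
        nlinarith
      · rw [Set.indicator_of_mem (by simpa using hω)]
        simp only [A, Set.mem_ofPred_eq, not_lt] at hω
        nlinarith
    rw [integral_const_mul, integral_sub (hdi n) hφd] at this
    linarith
  obtain ⟨t, htm, ht0, htd⟩ := exists_null_pairwise_disjoint_sdiff hAd
  refine ⟨fun n => A n \ t n, fun n => (hAm n).diff (htm n), htd, fun n => ?_⟩
  refine le_trans (le_of_eq ?_) (hAi n)
  refine setIntegral_congr_set ?_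
  exact (sdiff_null_ae_eq_self (ht0 n)).compl

end FiniteMeasure

/-! ### Reduction of an arbitrary measure to a finite one -/

/-- Weighted splittings along disjoint sets give a simultaneous splitting of a sequence of
functions dominated by multiples of one integrable function. -/
theorem exists_disjoint_sets_of_weighted {Ω : Type*} [MeasurableSpace Ω] {μ : Measure Ω}
    {f : ℕ → Ω → ℝ} (hf : ∀ n, Measurable (f n)) (hf0 : ∀ n ω, 0 ≤ f n ω)
    {w : Ω → ℝ} (hw : Measurable w) (hw0 : ∀ ω, 0 ≤ w ω) (hwi : Integrable w μ)
    {C : ℕ → ℝ} (hC : ∀ n, 0 ≤ C n) (hfw : ∀ n, ∀ᵐ ω ∂μ, f n ω ≤ C n * w ω) {s : ℝ}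
    (h : ∀ (F : Finset ℕ) (a : ℕ → ℝ), (∀ n, 0 ≤ a n) → ∑ n ∈ F, a n = 1 →
      ∃ B : ℕ → Set Ω, (∀ n, MeasurableSet (B n)) ∧ Pairwise (Function.onFun Disjoint B) ∧
        ∑ n ∈ F, a n * ∫ ω in (B n)ᶜ, f n ω ∂μ ≤ s) :
    ∃ A : ℕ → Set Ω, (∀ n, MeasurableSet (A n)) ∧ Pairwise (Function.onFun Disjoint A) ∧
      ∀ n, ∫ ω in (A n)ᶜ, f n ω ∂μ ≤ 2 * s := by
  -- Moving `w` into the measure makes it finite and turns `f n` into the bounded, hence square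
  -- integrable, quotient `f n / w`. Where `w = 0`, `f n` vanishes almost everywhere.
  let ν : Measure Ω := μ.withDensity fun ω => ENNReal.ofReal (w ω)
  have : IsFiniteMeasure ν := isFiniteMeasure_withDensity_ofReal hwi.2
  let d : ℕ → Ω → ℝ := fun n ω => f n ω / w ω
  have hd0 : ∀ n ω, 0 ≤ d n ω := fun n ω => div_nonneg (hf0 n ω) (hw0 ω)
  have hd : ∀ n, MemLp (d n) 2 ν := by
    intro n
    refine MemLp.of_bound ((hf n).div hw).aestronglyMeasurable (C n) ?_
    filter_upwards [(withDensity_absolutelyContinuous μ _).ae_le (hfw n)] with ω hω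
    rw [Real.norm_of_nonneg (hd0 n ω)]
    exact div_le_of_le_mul₀ (hw0 ω) (hC n) hω
  have hint : ∀ n (B : Set Ω), MeasurableSet B →
      ∫ ω in B, d n ω ∂ν = ∫ ω in B, f n ω ∂μ := by
    intro n B hB
    rw [setIntegral_withDensity_eq_setIntegral_toReal_smul hw.ennreal_ofReal
      (Filter.Eventually.of_forall fun _ => ENNReal.ofReal_lt_top) _ hB]
    refine integral_congr_ae (ae_restrict_of_ae ?_)
    filter_upwards [hfw n] with ω hω
    rw [ENNReal.toReal_ofReal (hw0 ω), smul_eq_mul]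
    refine mul_div_cancel_of_imp' fun h0 => ?_
    rw [h0, mul_zero] at hω
    exact le_antisymm hω (hf0 n ω)
  obtain ⟨A, hAm, hAd, hA⟩ := exists_disjoint_sets_of_weighted_finite hd hd0 (s := s) (by
    intro F a ha hsum
    obtain ⟨B, hBm, hBd, hB⟩ := h F a ha hsum
    refine ⟨B, hBm, hBd, ?_⟩
    simpa only [hint _ _ (hBm _).compl] using hB)
  exact ⟨A, hAm, hAd, fun n => (hint n _ (hAm n).compl).symm.trans_le (hA n)⟩

/-! ### Operators on `ℓ₁` through the unit vectors -/

section SequenceSpace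

variable {𝕜 : Type*} [RCLike 𝕜]

/-- The unit vector basis of `ℓ₁`. -/
noncomputable def seqUnit (𝕜 : Type*) [RCLike 𝕜] (n : ℕ) : SeqL1 𝕜 := lp.single 1 n (1 : 𝕜)

theorem seqUnit_apply (n m : ℕ) : seqUnit 𝕜 n m = if m = n then 1 else 0 := by
  rcases eq_or_ne m n with rfl | h
  · simp [seqUnit]
  · rw [seqUnit, lp.single_apply_ne _ _ _ h, if_neg h]

theorem norm_seqUnit (n : ℕ) : ‖seqUnit 𝕜 n‖ = 1 := by
  rw [seqUnit, lp.norm_single (by norm_num), norm_one]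

theorem hasSum_norm_seq (x : SeqL1 𝕜) : HasSum (fun n => ‖x n‖) ‖x‖ := by
  simpa using lp.hasSum_norm (by norm_num) x

theorem hasSum_smul_seqUnit (x : SeqL1 𝕜) : HasSum (fun n => x n • seqUnit 𝕜 n) x := by
  have h : ∀ n, x n • seqUnit 𝕜 n = lp.single 1 n (x n) := fun n => by
    rw [seqUnit, ← lp.single_smul, smul_eq_mul, mul_one]
  simpa only [h] using lp.hasSum_single (p := 1) (by norm_num) x

variable {E : Type*} [NormedAddCommGroup E] [NormedSpace 𝕜 E]

theorem hasSum_apply_seqUnit (R : SeqL1 𝕜 →L[𝕜] E) (x : SeqL1 𝕜) :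
    HasSum (fun n => x n • R (seqUnit 𝕜 n)) (R x) := by
  simpa using (hasSum_smul_seqUnit x).mapL R

theorem opNorm_le_of_seqUnit (R : SeqL1 𝕜 →L[𝕜] E) {C : ℝ} (hC : 0 ≤ C)
    (h : ∀ n, ‖R (seqUnit 𝕜 n)‖ ≤ C) : ‖R‖ ≤ C := by
  refine R.opNorm_le_bound hC fun x => ?_
  have hx := (hasSum_norm_seq x).mul_left C
  refine (hasSum_apply_seqUnit R x).tsum_eq ▸ tsum_of_norm_bounded hx fun n => ?_
  rw [norm_smul, mul_comm]
  exact mul_le_mul_of_nonneg_right (h n) (norm_nonneg _)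

theorem exists_op_of_bounded [CompleteSpace E] (g : ℕ → E) {C : ℝ} (hg : ∀ n, ‖g n‖ ≤ C) :
    ∃ R : SeqL1 𝕜 →L[𝕜] E, ∀ n, R (seqUnit 𝕜 n) = g n := by
  have hb : ∀ (x : SeqL1 𝕜) n, ‖x n • g n‖ ≤ C * ‖x n‖ := fun x n => by
    rw [norm_smul, mul_comm]
    exact mul_le_mul_of_nonneg_right (hg n) (norm_nonneg _)
  have hs : ∀ x : SeqL1 𝕜, Summable fun n => x n • g n := fun x =>
    Summable.of_norm_bounded ((hasSum_norm_seq x).mul_left C).summable (hb x)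
  let L : SeqL1 𝕜 →ₗ[𝕜] E :=
    { toFun := fun x => ∑' n, x n • g n
      map_add' := fun x y => by
        rw [← (hs x).tsum_add (hs y)]
        exact tsum_congr fun n => by rw [lp.coeFn_add, Pi.add_apply, add_smul]
      map_smul' := fun c x => by
        rw [RingHom.id_apply, ← (hs x).tsum_const_smul c]
        exact tsum_congr fun n => by rw [lp.coeFn_smul, Pi.smul_apply, smul_assoc] }
  refine ⟨L.mkContinuous C fun x =>
    tsum_of_norm_bounded ((hasSum_norm_seq x).mul_left C) (hb x), fun n => ?_⟩
  change ∑' m, seqUnit 𝕜 n m • g m = g n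
  rw [tsum_eq_single n fun m hm => by rw [seqUnit_apply, if_neg hm, zero_smul], seqUnit_apply,
    if_pos rfl, one_smul]

end SequenceSpace

/-! ### Positivity, modulus and the construction of `S` -/

section Modulus

variable {𝕜 : Type*} [RCLike 𝕜] {Ω : Type*} [MeasurableSpace Ω] {μ : Measure Ω}

theorem coeFn_funModulus (f : FunL1 𝕜 μ) : funModulus f =ᵐ[μ] fun ω => ‖f ω‖ :=
  MemLp.coeFn_toLp _

theorem continuous_funModulus : Continuous (funModulus : FunL1 𝕜 μ → Lp ℝ 1 μ) := by
  have h : (funModulus : FunL1 𝕜 μ → Lp ℝ 1 μ) =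
      (lipschitzWith_one_norm (E := 𝕜)).compLp norm_zero := by
    funext f
    refine Lp.ext ?_
    filter_upwards [coeFn_funModulus f,
      (lipschitzWith_one_norm (E := 𝕜)).coeFn_compLp norm_zero f] with ω h1 h2
    rw [h1, h2, Function.comp_apply]
  rw [h]
  exact LipschitzWith.continuous_compLp _ _

/-- Writes the positive cone as the fixed points of a continuous map, which shows that it is closed.
-/
theorem funNonneg_iff (f : FunL1 𝕜 μ) :
    FunNonneg f ↔ (RCLike.ofRealCLM (K := 𝕜)).compLp (funModulus f) = f := by
  have hc : (RCLike.ofRealCLM (K := 𝕜)).compLp (funModulus f) =ᵐ[μ] fun ω => (‖f ω‖ : 𝕜) := by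
    filter_upwards [(RCLike.ofRealCLM (K := 𝕜)).coeFn_compLp (funModulus f),
      coeFn_funModulus f] with ω h1 h2
    rw [h1, h2, RCLike.ofRealCLM_apply]
  constructor
  · intro h
    refine Lp.ext ?_
    filter_upwards [hc, h] with ω h1 h2
    rw [h1, RCLike.norm_of_nonneg' h2]
  · intro h
    rw [h] at hc
    filter_upwards [hc] with ω hω
    rw [hω]
    exact RCLike.ofReal_nonneg.2 (norm_nonneg _)

theorem isClosed_funNonneg : IsClosed {f : FunL1 𝕜 μ | FunNonneg f} := by
  simp only [funNonneg_iff]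
  refine isClosed_eq ?_ continuous_id
  exact ((RCLike.ofRealCLM (K := 𝕜)).compLpL 1 μ).continuous.comp continuous_funModulus

theorem coeFn_sum_smul (F : Finset ℕ) (x : ℕ → 𝕜) (g : ℕ → FunL1 𝕜 μ) :
    ∀ᵐ ω ∂μ, (∑ n ∈ F, x n • g n : FunL1 𝕜 μ) ω = ∑ n ∈ F, x n * g n ω := by
  have h := ae_all_iff.2 fun n => Lp.coeFn_smul (x n) (g n)
  filter_upwards [Lp.coeFn_finsetSum F fun n => x n • g n, h] with ω h1 h2
  rw [h1, Finset.sum_apply]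
  exact Finset.sum_congr rfl fun n _ => by rw [h2 n, Pi.smul_apply, smul_eq_mul]

theorem isPositiveOp_of_seqUnit (R : SeqL1 𝕜 →L[𝕜] FunL1 𝕜 μ)
    (h : ∀ n, FunNonneg (R (seqUnit 𝕜 n))) : IsPositiveOp R := by
  intro x hx
  refine isClosed_funNonneg.mem_of_tendsto (hasSum_apply_seqUnit R x)
    (Filter.Eventually.of_forall fun F => ?_)
  filter_upwards [coeFn_sum_smul F x fun n => R (seqUnit 𝕜 n), ae_all_iff.2 h] with ω h1 h2
  rw [h1]
  exact Finset.sum_nonneg fun n _ => mul_nonneg (hx n) (h2 n)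

/-- An operator mapping the unit vectors to functions living on disjoint sets is disjointness
preserving. -/
theorem isDP_of_disjoint_sets (R : SeqL1 𝕜 →L[𝕜] FunL1 𝕜 μ) (A : ℕ → Set Ω)
    (hA : Pairwise (Function.onFun Disjoint A))
    (h : ∀ n, ∀ᵐ ω ∂μ, ω ∉ A n → R (seqUnit 𝕜 n) ω = 0) : IsDP R := by
  intro x y hxy
  have hlim := ((continuous_funModulus.tendsto _).comp (hasSum_apply_seqUnit R x)).inf_nhds
    ((continuous_funModulus.tendsto _).comp (hasSum_apply_seqUnit R y))
  refine tendsto_nhds_unique hlim (tendsto_const_nhds.congr fun F => ?_)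
  refine Lp.ext ?_
  simp only [Function.comp_apply]
  filter_upwards [coeFn_sum_smul F x fun n => R (seqUnit 𝕜 n),
    coeFn_sum_smul F y fun n => R (seqUnit 𝕜 n), ae_all_iff.2 h,
    coeFn_funModulus (∑ n ∈ F, x n • R (seqUnit 𝕜 n)),
    coeFn_funModulus (∑ n ∈ F, y n • R (seqUnit 𝕜 n)),
    Lp.coeFn_inf (funModulus (∑ n ∈ F, x n • R (seqUnit 𝕜 n)))
      (funModulus (∑ n ∈ F, y n • R (seqUnit 𝕜 n))),
    Lp.coeFn_zero ℝ 1 μ] with ω h1 h2 h3 h4 h5 h6 h7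
  rw [h6, Pi.inf_apply, h4, h5, h1, h2, h7, Pi.zero_apply, eq_comm]
  -- At `ω` at most one unit vector has a nonzero image, so only the coordinates `x k` and `y k`
  -- matter, and one of them is zero.
  by_cases hk : ∃ k ∈ F, ω ∈ A k
  · obtain ⟨k, hkF, hk⟩ := hk
    have hz : ∀ n ∈ F, n ≠ k → R (seqUnit 𝕜 n) ω = 0 := fun n _ hn =>
      h3 n fun hmem => Set.disjoint_left.1 (hA hn) hmem hk
    rw [Finset.sum_eq_single_of_mem k hkF fun n hn hnk => by rw [hz n hn hnk, mul_zero],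
      Finset.sum_eq_single_of_mem k hkF fun n hn hnk => by rw [hz n hn hnk, mul_zero],
      norm_mul, norm_mul, ← min_mul_of_nonneg _ _ (norm_nonneg _)]
    exact mul_eq_zero_of_left (hxy k) _
  · push Not at hk
    rw [Finset.sum_eq_zero fun n hn => by rw [h3 n (hk n hn), mul_zero], norm_zero]
    exact min_eq_left (norm_nonneg _)

theorem seqNonneg_seqUnit (n : ℕ) : SeqNonneg (seqUnit 𝕜 n) := by
  intro m
  rw [seqUnit_apply]
  split_ifs
  · exact zero_le_one
  · exact le_rfl

/-- The images of the unit vectors under a positive operator are dominated by multiples of the image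
of a single vector. -/
theorem exists_dominating_vector (T : SeqL1 𝕜 →L[𝕜] FunL1 𝕜 μ) (hpos : IsPositiveOp T) :
    ∃ x : SeqL1 𝕜, ∀ n, ∀ᵐ ω ∂μ, ‖T (seqUnit 𝕜 n) ω‖ ≤ 2 ^ n * ‖T x ω‖ := by
  -- The vector is `x = ∑ 2⁻ⁿ eₙ`; apply positivity of `T` to `x - 2⁻ⁿ eₙ ≥ 0`.
  have hmem : Memℓp (fun n : ℕ => ((1 / 2 : ℝ) ^ n : 𝕜)) 1 := by
    refine memℓp_gen ?_
    simpa using summable_geometric_two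
  let x : SeqL1 𝕜 := ⟨_, hmem⟩
  have hx : ∀ n, x n = (((1 / 2 : ℝ) ^ n : ℝ) : 𝕜) := fun n => by
    simp [x]
  have hx0 : SeqNonneg x := fun n => by
    rw [hx]
    exact RCLike.ofReal_nonneg.2 (by positivity)
  refine ⟨x, fun n => ?_⟩
  let c : 𝕜 := (((1 / 2 : ℝ) ^ n : ℝ) : 𝕜)
  have hdiff : SeqNonneg (x - c • seqUnit 𝕜 n) := by
    intro m
    rw [lp.coeFn_sub, lp.coeFn_smul, Pi.sub_apply, Pi.smul_apply, seqUnit_apply]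
    split_ifs with h
    · rw [h, hx, smul_eq_mul, mul_one, sub_self]
    · rw [smul_zero, sub_zero]
      exact hx0 m
  have h := hpos _ hdiff
  rw [map_sub, map_smul] at h
  filter_upwards [h, Lp.coeFn_sub (T x) (c • T (seqUnit 𝕜 n)),
    Lp.coeFn_smul c (T (seqUnit 𝕜 n)), hpos _ (seqNonneg_seqUnit n)] with ω h1 h2 h3 h4
  rw [h2, Pi.sub_apply, h3, Pi.smul_apply, smul_eq_mul, sub_nonneg] at h1
  have hc : (0 : 𝕜) ≤ c := RCLike.ofReal_nonneg.2 (by positivity)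
  have hcn : ‖c‖ = (1 / 2) ^ n := by
    rw [RCLike.norm_ofReal, abs_of_nonneg (by positivity)]
  have h5 : ‖c * T (seqUnit 𝕜 n) ω‖ ≤ ‖T x ω‖ := by
    have hl := mul_nonneg hc h4
    rw [← RCLike.ofReal_le_ofReal (K := 𝕜), RCLike.norm_of_nonneg' hl,
      RCLike.norm_of_nonneg' (hl.trans h1)]
    exact h1
  rw [norm_mul, hcn] at h5
  calc ‖T (seqUnit 𝕜 n) ω‖ = 2 ^ n * ((1 / 2) ^ n * ‖T (seqUnit 𝕜 n) ω‖) := by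
        rw [← mul_assoc, ← mul_pow]; norm_num
    _ ≤ _ := mul_le_mul_of_nonneg_left h5 (by positivity)

/-- The `ε`-disjointness preserving property for finite nonnegative combinations of unit vectors. -/
theorem integral_min_le_of_isAlmostDP {T : SeqL1 𝕜 →L[𝕜] FunL1 𝕜 μ} (hpos : IsPositiveOp T)
    {ε : ℝ} (hε : 0 ≤ ε) (hDP : IsAlmostDP ε T) {I J : Finset ℕ} (hIJ : Disjoint I J)
    {a : ℕ → ℝ} (ha : ∀ n, 0 ≤ a n) (hI : ∑ n ∈ I, a n ≤ 1) (hJ : ∑ n ∈ J, a n ≤ 1) :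
    ∫ ω, min (∑ n ∈ I, a n * ‖T (seqUnit 𝕜 n) ω‖) (∑ n ∈ J, a n * ‖T (seqUnit 𝕜 n) ω‖) ∂μ ≤ ε := by
  let v : Finset ℕ → SeqL1 𝕜 := fun K => ∑ n ∈ K, (a n : 𝕜) • seqUnit 𝕜 n
  have hv : ∀ K m, v K m = if m ∈ K then (a m : 𝕜) else 0 := by
    intro K m
    simp only [v, lp.coeFn_sum, Finset.sum_apply, lp.coeFn_smul, Pi.smul_apply, seqUnit_apply,
      smul_eq_mul, mul_ite, mul_one, mul_zero, Finset.sum_ite_eq]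
  have hnorm : ∀ K, ∑ n ∈ K, a n ≤ 1 → ‖v K‖ ≤ 1 := by
    intro K hK
    refine (norm_sum_le _ _).trans (le_trans (le_of_eq ?_) hK)
    refine Finset.sum_congr rfl fun n _ => ?_
    rw [norm_smul, norm_seqUnit, mul_one, RCLike.norm_ofReal, abs_of_nonneg (ha n)]
  have hdisj : SeqDisjoint (v I) (v J) := by
    intro m
    rw [hv, hv]
    by_cases hm : m ∈ I
    · rw [if_neg (Finset.disjoint_left.1 hIJ hm), norm_zero]
      exact min_eq_right (norm_nonneg _)
    · rw [if_neg hm, norm_zero]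
      exact min_eq_left (norm_nonneg _)
  have hTv : ∀ K, funModulus (T (v K)) =ᵐ[μ] fun ω => ∑ n ∈ K, a n * ‖T (seqUnit 𝕜 n) ω‖ := by
    intro K
    have hT : T (v K) = ∑ n ∈ K, (a n : 𝕜) • T (seqUnit 𝕜 n) := by simp [v]
    rw [hT]
    filter_upwards [coeFn_funModulus (∑ n ∈ K, (a n : 𝕜) • T (seqUnit 𝕜 n)),
      coeFn_sum_smul K (fun n => (a n : 𝕜)) fun n => T (seqUnit 𝕜 n),
      ae_all_iff.2 fun n => hpos _ (seqNonneg_seqUnit n)] with ω h1 h2 h3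
    rw [h1, h2]
    have : ∑ n ∈ K, (a n : 𝕜) * T (seqUnit 𝕜 n) ω =
        ((∑ n ∈ K, a n * ‖T (seqUnit 𝕜 n) ω‖ : ℝ) : 𝕜) := by
      rw [RCLike.ofReal_sum]
      exact Finset.sum_congr rfl fun n _ => by
        rw [RCLike.ofReal_mul, RCLike.norm_of_nonneg' (h3 n)]
    rw [this, RCLike.norm_ofReal, abs_of_nonneg]
    exact Finset.sum_nonneg fun n _ => mul_nonneg (ha n) (norm_nonneg _)
  have hle := hDP _ _ hdisj
  rw [L1.norm_eq_integral_norm] at hle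
  refine le_trans (le_of_eq ?_) (hle.trans (mul_le_of_le_one_right hε
    (max_le (hnorm I hI) (hnorm J hJ))))
  refine integral_congr_ae ?_
  filter_upwards [Lp.coeFn_inf (funModulus (T (v I))) (funModulus (T (v J))), hTv I, hTv J]
    with ω h1 h2 h3
  rw [h1, Pi.inf_apply, h2, h3, Real.norm_of_nonneg]
  exact le_min (Finset.sum_nonneg fun n _ => mul_nonneg (ha n) (norm_nonneg _))
    (Finset.sum_nonneg fun n _ => mul_nonneg (ha n) (norm_nonneg _))

/-- A positive `ε`-disjointness preserving operator is within `16 ε / 3` of a disjointness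
preserving operator below it. -/
theorem exists_isDP_norm_sub_le (T : SeqL1 𝕜 →L[𝕜] FunL1 𝕜 μ) {ε : ℝ} (hε : 0 ≤ ε)
    (hpos : IsPositiveOp T) (hDP : IsAlmostDP ε T) :
    ∃ S : SeqL1 𝕜 →L[𝕜] FunL1 𝕜 μ,
      IsDP S ∧ OpLE 0 S ∧ OpLE S T ∧ ‖T - S‖ ≤ 16 / 3 * ε := by
  classical
  let f : ℕ → Ω → ℝ := fun n ω => ‖T (seqUnit 𝕜 n) ω‖
  have hf : ∀ n, Measurable (f n) := fun n =>
    (Lp.stronglyMeasurable (T (seqUnit 𝕜 n))).measurable.norm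
  have hf0 : ∀ n ω, 0 ≤ f n ω := fun n ω => norm_nonneg _
  have hfi : ∀ n, Integrable (f n) μ := fun n => (L1.integrable_coeFn _).norm
  obtain ⟨x, hx⟩ := exists_dominating_vector T hpos
  obtain ⟨A, hAm, hAd, hA⟩ := exists_disjoint_sets_of_weighted hf hf0
    (w := fun ω => ‖T x ω‖) (Lp.stronglyMeasurable (T x)).measurable.norm
    (fun _ => norm_nonneg _) (L1.integrable_coeFn (T x)).norm (C := fun n => 2 ^ n)
    (fun _ => by positivity) hx (s := 8 / 3 * ε) (by
      intro F a ha hsum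
      refine exists_disjoint_sets_weighted hf hf0 hfi F a ha
        (Finset.nonempty_of_ne_empty fun h => by simp [h] at hsum) fun I hI => ?_
      refine integral_min_le_of_isAlmostDP hpos hε hDP Finset.disjoint_sdiff ha ?_ ?_
      · exact (Finset.sum_le_sum_of_subset_of_nonneg hI fun n _ _ => ha n).trans_eq hsum
      · exact (Finset.sum_le_sum_of_subset_of_nonneg Finset.sdiff_subset
          fun n _ _ => ha n).trans_eq hsum)
  have hgm : ∀ n, MemLp ((A n).indicator (T (seqUnit 𝕜 n))) 1 μ := fun n =>
    (Lp.memLp (T (seqUnit 𝕜 n))).indicator (hAm n)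
  let g : ℕ → FunL1 𝕜 μ := fun n => (hgm n).toLp _
  have hg : ∀ n, g n =ᵐ[μ] (A n).indicator (T (seqUnit 𝕜 n)) := fun n => (hgm n).coeFn_toLp
  have hgT : ∀ n, ‖g n‖ ≤ ‖T‖ := by
    intro n
    have h1 : ‖g n‖ ≤ ‖T (seqUnit 𝕜 n)‖ := by
      refine Lp.norm_le_norm_of_ae_le ?_
      filter_upwards [hg n] with ω hω
      rw [hω]
      exact norm_indicator_le_norm_self _ _
    have h2 := T.le_opNorm (seqUnit 𝕜 n)
    rw [norm_seqUnit, mul_one] at h2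
    exact h1.trans h2
  obtain ⟨S, hS⟩ := exists_op_of_bounded (𝕜 := 𝕜) g hgT
  have hsub : ∀ n, (T - S) (seqUnit 𝕜 n) =ᵐ[μ] (A n)ᶜ.indicator (T (seqUnit 𝕜 n)) := by
    intro n
    rw [sub_apply, hS]
    filter_upwards [Lp.coeFn_sub (T (seqUnit 𝕜 n)) (g n), hg n] with ω h1 h2
    rw [h1, Pi.sub_apply, h2]
    by_cases hω : ω ∈ A n <;> simp [hω]
  refine ⟨S, isDP_of_disjoint_sets S A hAd fun n => ?_, ?_, ?_, ?_⟩
  · rw [hS]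
    filter_upwards [hg n] with ω hω hmem
    rw [hω, Set.indicator_of_notMem hmem]
  · rw [OpLE, sub_zero]
    refine isPositiveOp_of_seqUnit S fun n => ?_
    rw [hS]
    filter_upwards [hg n, hpos _ (seqNonneg_seqUnit n)] with ω h1 h2
    rw [h1]
    by_cases hω : ω ∈ A n <;> simp [hω, h2]
  · refine isPositiveOp_of_seqUnit _ fun n => ?_
    filter_upwards [hsub n, hpos _ (seqNonneg_seqUnit n)] with ω h1 h2
    rw [h1]
    by_cases hω : ω ∈ A n <;> simp [hω, h2]
  · refine opNorm_le_of_seqUnit _ (by positivity) fun n => ?_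
    rw [L1.norm_eq_integral_norm]
    have h : ∫ ω, ‖(T - S) (seqUnit 𝕜 n) ω‖ ∂μ = ∫ ω in (A n)ᶜ, f n ω ∂μ := by
      rw [← integral_indicator (hAm n).compl]
      refine integral_congr_ae ?_
      filter_upwards [hsub n] with ω hω
      rw [hω, norm_indicator_eq_indicator_norm]
    rw [h]
    have := hA n
    linarith

end Modulus

theorem theorem6p1 {𝕜 : Type*} [RCLike 𝕜] {Ω : Type*} [MeasurableSpace Ω] (μ : Measure Ω)
    (T : SeqL1 𝕜 →L[𝕜] FunL1 𝕜 μ) (ε : ℝ) (hε : 0 < ε) (hεT : ε < ‖T‖ / 16)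
    (hpos : IsPositiveOp T) (hDP : IsAlmostDP ε T) :
    ∃ S : SeqL1 𝕜 →L[𝕜] FunL1 𝕜 μ,
      IsDP S ∧ OpLE 0 S ∧ OpLE S T ∧ ‖T - S‖ ≤ 2 * Real.sqrt (2 * ε * ‖T‖ / 3) := by
  obtain ⟨S, hS, h0, hle, hnorm⟩ := exists_isDP_norm_sub_le T hε.le hpos hDP
  refine ⟨S, hS, h0, hle, hnorm.trans ?_⟩
  -- Squared, this is `32 ε ≤ 3 ‖T‖`, which `ε < ‖T‖ / 16` implies.
  have : 8 / 3 * ε ≤ Real.sqrt (2 * ε * ‖T‖ / 3) := by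
    refine Real.le_sqrt_of_sq_le ?_
    nlinarith
  linarith
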